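/- Definitions. A range set is a set $R\subseteq[0,\infty)$ with $0\in R$. An ultrametric space $(X,d)$ is $R$-valued if $d(x,y)\in R$ for all $x,y\in X$. A metric space $X$ is injective for the finite $R$-valued ultrametric spaces if it is nonempty and, for all finite $R$-valued ultrametric spaces $Y,Z$ and all isometric embeddings $\phi\colon Y\to Z$ and $f\colon Y\to X$, there is an isometric embedding $F\colon Z\to X$ with $F\circ\phi=f$. A range set $S$ is tenuous if it is finite or of the form $\{0\}\cup\{a_i\mid i\ge 0\}$ for a strictly decreasing sequence $(a_i)$ of positive reals with limit $0$. If $R$ is finite or countable, the $R$-Urysohn universal ultrametric space is the (unique up to isometry) separable complete $R$-valued ultrametric space that is injective for the finite $R$-valued ultrametric spaces. If $R$ is uncountable, it is the (unique up to isometry) $R$-petaloid space, i.e. the $R$-valued ultrametric space $(X,d)$ for which there is a family $(\Pi_S)$ of nonempty subspaces of $X$, indexed by the tenuous range sets $S\subseteq R$, such that 1. for every $S\ne\{0\}$, $\Pi_S$ is the $S$-Urysohn universal ultrametric space; 2. $\bigcup_S\Pi_S=X$; 3. $\Pi_S\cap\Pi_T=\Pi_{S\cap T}$ for all $S,T$;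 4. $d(x,\Pi_S)=\inf_{y\in \Pi_S}d(x,y)\in\{0\}\cup(T\setminus S)$ for all $S,T$ and all $x\in\Pi_T$. Theorem. Let $m\in\mathbb{Z}_{\ge 2}\cup\{\infty\}$, let $R$ be a range set, let $l\in(0,\infty]$, and let $(X,d)$ be the $R$-Urysohn universal ultrametric space. Let $\mathcal{K}_{m,l}(X)$ be the set of all nonempty compact subsets $E$ of $X$ with at most $m$ points and with diameter at most $l$ (where $m=\infty$, respectively $l=\infty$, means no restriction), equipped with the Hausdorff metric $$d_H(E,F)=\max\Big\{\sup_{a\in E}d(a,F),\ \sup_{b\in F}d(b,E)\Big\}.$$ Then $(\mathcal{K}_{m,l}(X),d_H)$ is the $R$-Urysohn universal ultrametric space. In particular, it is isometric to $(X,d)$. (The case $m=l=\infty$ is the space $\mathcal{K}(X)$ of all nonempty compact subsets; the case $l=\infty$, $m<\infty$ is the $m$-th symmetric product.) -/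

import Mathlib

open Set Filter Topology TopologicalSpace
open scoped ENNReal

/-- A range set: a subset of `[0, ∞)` that contains `0`. -/
def IsRangeSet (R : Set ℝ) : Prop :=
  R ⊆ Ici 0 ∧ (0 : ℝ) ∈ R

/-- `X` is an ultrametric space all of whose distances lie in `R`. -/
structure IsValuedUltrametric (R : Set ℝ) (X : Type*) [MetricSpace X] : Prop where
  ultra : IsUltrametricDist X
  dist_mem : ∀ x y : X, dist x y ∈ R

/-- Injectivity for the class of all finite `R`-valued ultrametric spaces: `X` is nonempty, and
for all finite `R`-valued ultrametric spaces `Y` and `Z` (possibly empty) and isometric embeddings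
`φ : Y → Z` and `f : Y → X`, there is an isometric embedding `F : Z → X` with `F ∘ φ = f`. -/
def IsFiniteUltrametricInjective (R : Set ℝ) (X : Type*) [MetricSpace X] : Prop :=
  Nonempty X ∧
    ∀ (Y Z : Type) [MetricSpace Y] [MetricSpace Z] [Finite Y] [Finite Z],
      IsValuedUltrametric R Y → IsValuedUltrametric R Z →
      ∀ (φ : Y → Z) (f : Y → X), Isometry φ → Isometry f →
        ∃ F : Z → X, Isometry F ∧ F ∘ φ = f

/-- `X` is a separable complete `R`-valued ultrametric space that is injective for the finite
`R`-valued ultrametric spaces. For a finite or countable range set `R`, this is what it means to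
be the `R`-Urysohn universal ultrametric space. -/
structure IsSeparableUrysohnUltrametric (R : Set ℝ) (X : Type*) [MetricSpace X] : Prop where
  separable : SeparableSpace X
  complete : CompleteSpace X
  injective : IsFiniteUltrametricInjective R X
  valued : IsValuedUltrametric R X

/-- `E = {0} ∪ {a i | i}` for a strictly decreasing sequence `a` of positive reals with limit
zero. -/
def IsSemiSporadic (E : Set ℝ) : Prop :=
  ∃ a : ℕ → ℝ, StrictAnti a ∧ (∀ i, 0 < a i) ∧ Tendsto a atTop (𝓝 0) ∧ E = {0} ∪ range a

/-- A set is tenuous if it is finite or semi-sporadic. -/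
def IsTenuous (E : Set ℝ) : Prop :=
  E.Finite ∨ IsSemiSporadic E

/-- The family of all tenuous range sets contained in `R`. -/
def tenuousRangeSubsets (R : Set ℝ) : Set (Set ℝ) :=
  {S | IsRangeSet S ∧ IsTenuous S ∧ S ⊆ R}

/-- The family `P` of (nonempty) subspaces of `X`, of which only the members with index a tenuous
range subset of `R` matter, is an `R`-petal of `X`. Nonemptiness is recorded since
`Metric.infDist x ∅ = 0` in Mathlib, whereas the distance to the empty set is an infimum over
the empty set; it only adds something for `S = {0}`. -/
structure IsPetal (R : Set ℝ) (X : Type*) [MetricSpace X] (P : Set ℝ → Set X) : Prop where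
  nonempty : ∀ S ∈ tenuousRangeSubsets R, (P S).Nonempty
  urysohn : ∀ S ∈ tenuousRangeSubsets R, S ≠ {0} → IsSeparableUrysohnUltrametric S (P S)
  iUnion_eq : ⋃ S ∈ tenuousRangeSubsets R, P S = univ
  inter_eq : ∀ S ∈ tenuousRangeSubsets R, ∀ T ∈ tenuousRangeSubsets R,
    P S ∩ P T = P (S ∩ T)
  infDist_mem : ∀ S ∈ tenuousRangeSubsets R, ∀ T ∈ tenuousRangeSubsets R, ∀ x ∈ P T,
    Metric.infDist x (P S) ∈ ({0} ∪ (T \ S) : Set ℝ)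

/-- `X` is an `R`-petaloid ultrametric space (a notion used for uncountable `R`). -/
structure IsPetaloid (R : Set ℝ) (X : Type*) [MetricSpace X] : Prop where
  valued : IsValuedUltrametric R X
  exists_petal : ∃ P : Set ℝ → Set X, IsPetal R X P

/-- `X` is the `R`-Urysohn universal ultrametric space: for `R` finite or countable it is the
separable complete injective one, for `R` uncountable it is the petaloid one. -/
def IsUrysohnUniversalUltrametric (R : Set ℝ) (X : Type*) [MetricSpace X] : Prop :=
  (R.Countable → IsSeparableUrysohnUltrametric R X) ∧ (¬ R.Countable → IsPetaloid R X)

/-- The space of nonempty compact subsets of `X` with at most `m` points and diameter at most `l`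
(no restriction for the value `⊤`). Its metric is the restriction of the metric of
`NonemptyCompacts X`, which is the Hausdorff distance. -/
abbrev BoundedHyperspace (X : Type*) [MetricSpace X] (m : ℕ∞) (l : ℝ≥0∞) : Type _ :=
  {E : NonemptyCompacts X // (E : Set X).encard ≤ m ∧ Metric.ediam (E : Set X) ≤ l}

/-! ### Tenuous range sets -/

/-- A set of reals that has only finitely many elements above every positive bound. -/
def IsFiniteAwayFromZero (S : Set ℝ) : Prop :=
  ∀ δ > 0, (S ∩ Ici δ).Finite

theorem IsTenuous.isFiniteAwayFromZero {S : Set ℝ} (hS : IsTenuous S) :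
    IsFiniteAwayFromZero S := by
  intro δ hδ
  rcases hS with hS | ⟨a, -, -, h2, rfl⟩
  · exact hS.subset inter_subset_left
  · obtain ⟨N, hN⟩ := eventually_atTop.1 (h2.eventually_lt_const hδ)
    refine ((finite_Iio N).image a).subset ?_
    rintro x ⟨hx | ⟨i, rfl⟩, hx'⟩
    · rw [mem_singleton_iff.1 hx] at hx'
      exact absurd hδ (not_lt.2 hx')
    · exact ⟨i, by_contra fun h => absurd (hN i (not_lt.1 h)) (not_lt.2 hx'), rfl⟩

theorem IsFiniteAwayFromZero.mono {S T : Set ℝ} (hT : IsFiniteAwayFromZero T) (h : S ⊆ T) :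
    IsFiniteAwayFromZero S :=
  fun δ hδ => (hT δ hδ).subset (inter_subset_inter_left _ h)

theorem IsFiniteAwayFromZero.union {S T : Set ℝ} (hS : IsFiniteAwayFromZero S)
    (hT : IsFiniteAwayFromZero T) : IsFiniteAwayFromZero (S ∪ T) := by
  intro δ hδ
  rw [union_inter_distrib_right]
  exact (hS δ hδ).union (hT δ hδ)

theorem Set.Finite.isFiniteAwayFromZero {S : Set ℝ} (hS : S.Finite) : IsFiniteAwayFromZero S :=
  fun _ _ => hS.subset inter_subset_left

/-- A nonempty set of positive reals which is finite away from zero has a greatest element. -/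
theorem IsFiniteAwayFromZero.exists_isGreatest {V : Set ℝ} (hV : IsFiniteAwayFromZero V)
    (hpos : ∀ x ∈ V, 0 < x) (hne : V.Nonempty) : ∃ x, IsGreatest V x := by
  obtain ⟨v, hv⟩ := hne
  obtain ⟨x, hx, hmax⟩ :=
    Set.exists_max_image (V ∩ Ici v) id (hV v (hpos v hv)) ⟨v, hv, mem_Ici.2 le_rfl⟩
  refine ⟨x, hx.1, fun y hy => ?_⟩
  rcases le_total v y with h | h
  · exact hmax y ⟨hy, h⟩
  · exact h.trans hx.2

/-- An infinite such set is listed downwards from its maximum, passing each time to the greatest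
element below. Finiteness above each bound drives the list to zero, so no positive element is
skipped. -/
theorem IsFiniteAwayFromZero.isTenuous {S : Set ℝ} (hS : IsFiniteAwayFromZero S)
    (hR : IsRangeSet S) : IsTenuous S := by
  by_cases hfin : S.Finite
  · exact Or.inl hfin
  right
  have hV : ∀ b : ℝ, 0 < b → (S ∩ Ioo 0 b).Nonempty := by
    intro b hb
    by_contra h
    rw [not_nonempty_iff_eq_empty] at h
    refine hfin (((hS b hb).union (finite_singleton 0)).subset fun x hx => ?_)
    rcases (show 0 ≤ x from hR.1 hx).eq_or_lt with h0 | h0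
    · exact Or.inr h0.symm
    · refine Or.inl ⟨hx, mem_Ici.2 (not_lt.1 fun hxb => ?_)⟩
      exact (h ▸ (⟨hx, h0, hxb⟩ : x ∈ S ∩ Ioo 0 b) : x ∈ (∅ : Set ℝ))
  have hg : ∀ b : ℝ, ∃ c, 0 < b → IsGreatest (S ∩ Ioo 0 b) c := by
    intro b
    by_cases hb : 0 < b
    · obtain ⟨c, hc⟩ := (hS.mono inter_subset_left).exists_isGreatest
        (fun x hx => hx.2.1) (hV b hb)
      exact ⟨c, fun _ => hc⟩
    · exact ⟨0, fun h => absurd h hb⟩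
  choose g hg using hg
  obtain ⟨a0, ha0⟩ : ∃ c, IsGreatest (S ∩ Ioi 0) c := by
    refine (hS.mono inter_subset_left).exists_isGreatest (fun x hx => hx.2) ?_
    obtain ⟨x, hx⟩ := hV 1 one_pos
    exact ⟨x, hx.1, hx.2.1⟩
  let a : ℕ → ℝ := fun n => g^[n] a0
  have hsucc : ∀ n, a (n + 1) = g (a n) := fun n => Function.iterate_succ_apply' g n a0
  have hpos : ∀ n, 0 < a n := by
    intro n
    induction n with
    | zero => exact ha0.1.2
    | succ n ih => rw [hsucc]; exact (hg _ ih).1.2.1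
  have hanti : StrictAnti a := strictAnti_nat_of_succ_lt fun n => by
    rw [hsucc]; exact (hg _ (hpos n)).1.2.2
  have hmem : ∀ n, a n ∈ S := by
    rintro (_ | n)
    · exact ha0.1.1
    · rw [hsucc]; exact (hg _ (hpos n)).1.1
  have hsmall : ∀ δ > 0, ∃ n, a n < δ := by
    intro δ hδ
    by_contra! h
    exact (infinite_range_of_injective hanti.injective)
      ((hS δ hδ).subset (range_subset_iff.2 fun n => ⟨hmem n, h n⟩))
  refine ⟨a, hanti, hpos, ?_, ?_⟩
  · rw [Metric.tendsto_atTop]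
    intro ε hε
    obtain ⟨N, hN⟩ := hsmall ε hε
    refine ⟨N, fun n hn => ?_⟩
    rw [Real.dist_eq, sub_zero, abs_of_pos (hpos n)]
    exact (hanti.antitone hn).trans_lt hN
  · refine Subset.antisymm (fun x hx => ?_) ?_
    · rcases (show 0 ≤ x from hR.1 hx).eq_or_lt with h0 | h0
      · exact Or.inl h0.symm
      right
      by_contra hxr
      have hlt : ∀ n, x < a n := by
        intro n
        have hne : x ≠ a n := fun h => hxr ⟨n, h.symm⟩
        induction n with
        | zero => exact lt_of_le_of_ne (ha0.2 ⟨hx, h0⟩) hne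
        | succ n ih =>
          refine lt_of_le_of_ne ?_ hne
          rw [hsucc]
          exact (hg _ (hpos n)).2 ⟨hx, h0, ih fun h => hxr ⟨n, h.symm⟩⟩
      obtain ⟨n, hn⟩ := hsmall x h0
      exact absurd (hlt n) hn.not_gt
    · rintro x (rfl | ⟨n, rfl⟩)
      · exact hR.2
      · exact hmem n

/-- Trades sequences for a condition that is visibly stable under unions and subsets. -/
theorem mem_tenuousRangeSubsets {R S : Set ℝ} (hR : IsRangeSet R) :
    S ∈ tenuousRangeSubsets R ↔ 0 ∈ S ∧ IsFiniteAwayFromZero S ∧ S ⊆ R :=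
  ⟨fun h => ⟨h.1.2, h.2.1.isFiniteAwayFromZero, h.2.2⟩, fun h =>
    have hS : IsRangeSet S := ⟨h.2.2.trans hR.1, h.1⟩
    ⟨hS, h.2.1.isTenuous hS, h.2.2⟩⟩

/-! ### Injectivity as equidistant extension -/

/-- Every finite set of diameter at most `r ∈ R`, `r > 0`, admits a point at distance exactly `r`
from all of its points. -/
def HasEquidistantExtension (R : Set ℝ) (X : Type*) [MetricSpace X] : Prop :=
  ∀ r ∈ R, 0 < r → ∀ A : Set X, A.Finite → (∀ x ∈ A, ∀ y ∈ A, dist x y ≤ r) →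
    ∃ p, ∀ x ∈ A, dist p x = r

/-- The space `Y` with one more point, at distance `r` from all points of `Y`. -/
abbrev adjoinPointMetric (Y : Type*) [MetricSpace Y] (r : ℝ) (hr : 0 < r)
    (h : ∀ x y : Y, dist x y ≤ r) : MetricSpace (Option Y) where
  dist
    | none, none => 0
    | none, some _ => r
    | some _, none => r
    | some x, some y => dist x y
  dist_self := by rintro (_ | x) <;> simp
  dist_comm := by rintro (_ | x) (_ | y) <;> simp [dist_comm]
  dist_triangle := by
    rintro (_ | x) (_ | y) (_ | z) <;> simp [hr.le]
    · exact (h x z).trans (by linarith)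
    · exact dist_triangle _ _ _
  eq_of_dist_eq_zero := by
    rintro (_ | x) (_ | y) <;> simp [hr.ne']

theorem IsFiniteUltrametricInjective.hasEquidistantExtension {R : Set ℝ} {X : Type*}
    [MetricSpace X] (h0 : 0 ∈ R) (hX : IsFiniteUltrametricInjective R X)
    (hv : IsValuedUltrametric R X) : HasEquidistantExtension R X := by
  intro r hr hrpos A hA hAr
  -- Injectivity only tests spaces in `Type`, so `A` is copied onto some `Fin n`.
  obtain ⟨Y, _, f, hf, hfA⟩ : ∃ (Y : Type) (_ : Finite Y) (f : Y → X),
      Function.Injective f ∧ range f = A := by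
    have := hA.to_subtype
    obtain ⟨n, ⟨e⟩⟩ := Finite.exists_equiv_fin A
    refine ⟨Fin n, inferInstance, Subtype.val ∘ e.symm,
      Subtype.val_injective.comp e.symm.injective, ?_⟩
    rw [range_comp, e.symm.range_eq_univ, image_univ, Subtype.range_coe]
  let := MetricSpace.induced f hf inferInstance
  have hYX : ∀ x y : Y, dist x y = dist (f x) (f y) := fun _ _ => rfl
  have hY : IsValuedUltrametric R Y :=
    ⟨⟨fun x y z => hv.ultra.dist_triangle_max _ _ _⟩, fun x y => hv.dist_mem _ _⟩
  have hYr : ∀ x y : Y, dist x y ≤ r := fun x y =>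
    hAr _ (hfA ▸ mem_range_self x) _ (hfA ▸ mem_range_self y)
  let := adjoinPointMetric Y r hrpos hYr
  have hns : ∀ x : Y, dist (none : Option Y) (some x) = r := fun _ => rfl
  have hsn : ∀ x : Y, dist (some x : Option Y) none = r := fun _ => rfl
  have hss : ∀ x y : Y, dist (some x : Option Y) (some y) = dist x y := fun _ _ => rfl
  have hZ : IsValuedUltrametric R (Option Y) := by
    refine ⟨⟨?_⟩, ?_⟩
    · rintro (_ | x) (_ | y) (_ | z) <;> simp [hns, hsn, hss, hrpos.le, hYr]
      exact le_max_iff.1 (hY.ultra.dist_triangle_max _ _ _)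
    · rintro (_ | x) (_ | y) <;> simp [hns, hsn, hss, hr, h0, hY.dist_mem]
  obtain ⟨F, hF, hFf⟩ := hX.2 Y (Option Y) hY hZ some f
    (Isometry.of_dist_eq hss) (Isometry.of_dist_eq fun _ _ => rfl)
  refine ⟨F none, fun x hx => ?_⟩
  obtain ⟨y, rfl⟩ := hfA ▸ hx
  rw [← congrFun hFf y, Function.comp_apply, hF.dist_eq, hns]

/-- Points of `Z` are added one at a time. Only the old points nearest to the new point `z` need
care, and they are equidistant from it; for a farther `b`, the isosceles property gives `dist z b =
dist b₀ b` with `b₀` nearest, and likewise in `X`. -/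
theorem HasEquidistantExtension.isFiniteUltrametricInjective {R : Set ℝ} {X : Type*}
    [MetricSpace X] [Nonempty X] (hX : HasEquidistantExtension R X)
    (hv : IsValuedUltrametric R X) : IsFiniteUltrametricInjective R X := by
  refine ⟨inferInstance, fun Y Z _ _ _ _ hY hZ φ f hφ hf => ?_⟩
  have := hv.ultra
  have := hZ.ultra
  classical
  suffices H : ∀ B : Set Z, B.Finite → ∃ F : Z → X,
      (∀ y, F (φ y) = f y) ∧ ∀ a ∈ range φ ∪ B, ∀ b ∈ range φ ∪ B,
        dist (F a) (F b) = dist a b by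
    obtain ⟨F, hF, hF'⟩ := H univ finite_univ
    exact ⟨F, Isometry.of_dist_eq fun a b => hF' a (by simp) b (by simp), funext hF⟩
  intro B hB
  induction B, hB using Set.Finite.induction_on with
  | empty =>
    refine ⟨Function.extend φ f fun _ => Classical.arbitrary X,
      fun y => hφ.injective.extend_apply _ _ _, ?_⟩
    rw [union_empty]
    rintro _ ⟨a, rfl⟩ _ ⟨b, rfl⟩
    rw [hφ.injective.extend_apply, hφ.injective.extend_apply, hf.dist_eq, hφ.dist_eq]
  | @insert z B _ _ ih =>
    obtain ⟨F, hF, hF'⟩ := ih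
    rw [union_insert]
    set C := range φ ∪ B with hC
    by_cases hz : z ∈ C
    · rw [insert_eq_of_mem hz]
      exact ⟨F, hF, hF'⟩
    have hzφ : ∀ y, φ y ≠ z := fun y h => hz (h ▸ Or.inl (mem_range_self y))
    obtain ⟨p, hp⟩ : ∃ p, ∀ b ∈ C, dist p (F b) = dist z b := by
      rcases C.eq_empty_or_nonempty with h | h
      · exact ⟨Classical.arbitrary X, by simp [h]⟩
      obtain ⟨b₀, hb₀, hmin⟩ := Set.exists_min_image C (fun b => dist z b) (Set.toFinite C) h
      have hr : 0 < dist z b₀ := dist_pos.2 fun h => hz (h ▸ hb₀)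
      obtain ⟨p, hp⟩ := hX (dist z b₀) (hZ.dist_mem _ _) hr
        (F '' {b ∈ C | dist z b = dist z b₀}) (Set.toFinite _) (by
          rintro _ ⟨a, ha, rfl⟩ _ ⟨b, hb, rfl⟩
          rw [hF' a ha.1 b hb.1]
          refine (dist_triangle_max a z b).trans ?_
          rw [dist_comm, ha.2, hb.2, max_self])
      refine ⟨p, fun b hb => ?_⟩
      rcases (hmin b hb).eq_or_lt with h | h
      · exact (hp _ ⟨b, ⟨hb, h.symm⟩, rfl⟩).trans h
      · have h1 : dist p (F b₀) = dist z b₀ := hp _ ⟨b₀, ⟨hb₀, rfl⟩, rfl⟩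
        have h2 : dist b₀ b = dist z b := by
          have := dist_triangle_max z b₀ b
          have := dist_triangle_max b₀ z b
          rw [dist_comm b₀ z] at this
          grind
        have h3 : dist (F b₀) (F b) = dist z b := by rw [hF' _ hb₀ _ hb, h2]
        have h4 := dist_triangle_max p (F b₀) (F b)
        have h5 := dist_triangle_max (F b₀) p (F b)
        rw [dist_comm (F b₀) p] at h5
        grind
    refine ⟨Function.update F z p, fun y => ?_, ?_⟩
    · rw [Function.update_of_ne (hzφ y), hF]
    · have hne : ∀ b ∈ C, b ≠ z := fun b hb h => hz (h ▸ hb)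
      rintro a (rfl | ha) b (rfl | hb)
      · simp
      · rw [Function.update_self, Function.update_of_ne (hne b hb), hp b hb]
      · rw [Function.update_self, Function.update_of_ne (hne a ha), dist_comm, hp a ha, dist_comm]
      · rw [Function.update_of_ne (hne a ha), Function.update_of_ne (hne b hb), hF' a ha b hb]

/-! ### The Hausdorff metric and the countable case -/

section Hausdorff

variable {X : Type*} [MetricSpace X]

theorem TopologicalSpace.NonemptyCompacts.exists_dist_le (E F : NonemptyCompacts X) {x : X}
    (hx : x ∈ (E : Set X)) : ∃ y ∈ (F : Set X), dist x y ≤ dist E F := by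
  obtain ⟨y, hy, h⟩ := F.isCompact.exists_infDist_eq_dist F.nonempty x
  exact ⟨y, hy, h ▸ Metric.infDist_le_hausdorffDist_of_mem hx (edist_ne_top E F)⟩

theorem TopologicalSpace.NonemptyCompacts.dist_le_of_forall {E F : NonemptyCompacts X} {r : ℝ}
    (h₁ : ∀ x ∈ (E : Set X), ∃ y ∈ (F : Set X), dist x y ≤ r)
    (h₂ : ∀ y ∈ (F : Set X), ∃ x ∈ (E : Set X), dist y x ≤ r) : dist E F ≤ r := by
  have hr : 0 ≤ r := by
    obtain ⟨x, hx⟩ := E.nonempty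
    obtain ⟨y, -, h⟩ := h₁ x hx
    exact dist_nonneg.trans h
  exact Metric.hausdorffDist_le_of_mem_dist hr h₁ h₂

/-- The Hausdorff distance of two compact sets is a distance between two of their points. -/
theorem TopologicalSpace.NonemptyCompacts.exists_dist_eq (E F : NonemptyCompacts X) :
    ∃ x y : X, dist E F = dist x y := by
  -- By symmetry the one-sided excess of `E` over `F` dominates; a point of `E` farthest from `F`
  -- and its nearest point in `F` then realize the distance.
  wlog H : ∀ y ∈ (F : Set X), ∃ x ∈ (E : Set X), Metric.infDist y E ≤ Metric.infDist x F
    generalizing E F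
  · obtain ⟨x, y, h⟩ := this F E fun x hx => by
      push Not at H
      obtain ⟨y, hy, h⟩ := H
      exact ⟨y, hy, (h x hx).le⟩
    exact ⟨x, y, dist_comm E F ▸ h⟩
  obtain ⟨x, hx, hmax⟩ := E.isCompact.exists_isMaxOn E.nonempty
    (Metric.continuous_infDist_pt (F : Set X)).continuousOn
  obtain ⟨y, hy, h⟩ := F.isCompact.exists_infDist_eq_dist F.nonempty x
  refine ⟨x, y, le_antisymm ?_ ?_⟩
  · rw [← h]
    refine Metric.hausdorffDist_le_of_infDist Metric.infDist_nonneg (fun z hz => hmax hz) ?_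
    intro z hz
    obtain ⟨w, hw, hzw⟩ := H z hz
    exact hzw.trans (hmax hw)
  · rw [← h]
    exact Metric.infDist_le_hausdorffDist_of_mem hx (edist_ne_top E F)

instance TopologicalSpace.NonemptyCompacts.instIsUltrametricDist [IsUltrametricDist X] :
    IsUltrametricDist (NonemptyCompacts X) := by
  refine ⟨fun E F G => ?_⟩
  have key : ∀ E F G : NonemptyCompacts X, ∀ x ∈ (E : Set X), ∃ z ∈ (G : Set X),
      dist x z ≤ max (dist E F) (dist F G) := by
    intro E F G x hx
    obtain ⟨y, hy, hxy⟩ := E.exists_dist_le F hx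
    obtain ⟨z, hz, hyz⟩ := F.exists_dist_le G hy
    exact ⟨z, hz, (dist_triangle_max x y z).trans (max_le_max hxy hyz)⟩
  refine NonemptyCompacts.dist_le_of_forall (key E F G) fun z hz => ?_
  rw [dist_comm E F, dist_comm F G, max_comm]
  exact key G F E z hz

variable {m : ℕ∞} {l : ℝ≥0∞}

theorem IsValuedUltrametric.boundedHyperspace {R : Set ℝ} (hX : IsValuedUltrametric R X) :
    IsValuedUltrametric R (BoundedHyperspace X m l) := by
  have := hX.ultra
  refine ⟨⟨fun E F G => dist_triangle_max E.1 F.1 G.1⟩, fun E F => ?_⟩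
  obtain ⟨x, y, h⟩ := E.1.exists_dist_eq F.1
  exact (show dist E F = dist x y from h) ▸ hX.dist_mem x y

/-- If `E` had `m + 1` points, a set closer to `E` than half their separation would contain distinct
points near each of them. -/
theorem isClosed_setOf_encard_le (m : ℕ∞) :
    IsClosed {E : NonemptyCompacts X | (E : Set X).encard ≤ m} := by
  refine isClosed_of_closure_subset fun E hE => ?_
  rw [Metric.mem_closure_iff] at hE
  by_contra h
  replace h : m < (E : Set X).encard := not_le.1 h
  obtain ⟨t, htE, ht⟩ := exists_subset_encard_eq (Order.add_one_le_of_lt h)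
  have hm : m ≠ ⊤ := h.ne_top
  have htfin : t.Finite := by
    rw [← encard_ne_top_iff, ht]
    exact WithTop.add_ne_top.2 ⟨hm, ENat.one_ne_top⟩
  obtain ⟨δ, hδ, hsep⟩ : ∃ δ > 0, ∀ x ∈ t, ∀ y ∈ t, x ≠ y → δ ≤ dist x y := by
    by_cases hts : t.Nontrivial
    · exact ⟨_, htfin.infsep_pos_iff_nontrivial.2 hts, fun x hx y hy hxy =>
        infsep_le_dist_of_mem hx hy hxy⟩
    · exact ⟨1, one_pos, fun x hx y hy hxy => absurd ⟨x, hx, y, hy, hxy⟩ hts⟩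
  obtain ⟨F, hF, hEF⟩ := hE (δ / 2) (by positivity)
  have hg : ∀ x : X, ∃ y, x ∈ t → y ∈ (F : Set X) ∧ dist x y < δ / 2 := by
    intro x
    by_cases hx : x ∈ t
    · obtain ⟨y, hy, hxy⟩ := E.exists_dist_le F (htE hx)
      exact ⟨y, fun _ => ⟨hy, hxy.trans_lt hEF⟩⟩
    · exact ⟨x, fun h => absurd h hx⟩
  choose g hg using hg
  have hinj : InjOn g t := by
    intro x hx y hy hxy
    by_contra hne
    have h1 := hsep x hx y hy hne
    have h2 := dist_triangle_right x y (g x)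
    have h3 := (hg x hx).2
    have h4 := (hg y hy).2
    rw [← hxy] at h4
    linarith
  have h1 : m + 1 ≤ m := by
    rw [← ht, ← hinj.encard_image]
    exact (encard_le_encard (image_subset_iff.2 fun x hx => (hg x hx).1)).trans hF
  exact absurd h1 (not_le.2 (ENat.lt_add_one_iff hm |>.2 le_rfl))

/-- In an ultrametric space, moving `x` and `y` by less than `dist x y` leaves their distance
unchanged. -/
theorem isClosed_setOf_ediam_le [IsUltrametricDist X] (l : ℝ≥0∞) :
    IsClosed {E : NonemptyCompacts X | Metric.ediam (E : Set X) ≤ l} := by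
  refine isClosed_of_closure_subset fun E hE => ?_
  rw [Metric.mem_closure_iff] at hE
  refine Metric.ediam_le fun x hx y hy => ?_
  rcases eq_or_ne x y with rfl | hxy
  · simp
  obtain ⟨F, hF, hEF⟩ := hE (dist x y) (dist_pos.2 hxy)
  obtain ⟨x', hx', hxx⟩ := E.exists_dist_le F hx
  obtain ⟨y', hy', hyy⟩ := E.exists_dist_le F hy
  refine le_trans ?_ ((Metric.edist_le_ediam_of_mem hx' hy').trans hF)
  rw [edist_dist, edist_dist]
  refine ENNReal.ofReal_le_ofReal ?_
  have h1 := dist_triangle_max x x' y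
  have h2 := dist_triangle_max x' y' y
  rw [dist_comm y' y] at h2
  grind

theorem completeSpace_boundedHyperspace [IsUltrametricDist X] [CompleteSpace X] :
    CompleteSpace (BoundedHyperspace X m l) :=
  ((isClosed_setOf_encard_le m).inter (isClosed_setOf_ediam_le l)).completeSpace_coe

/-- The image of a set in the bounded hyperspace under a map that does not increase distances
on it. -/
theorem BoundedHyperspace.exists_image (E : BoundedHyperspace X m l) (h : X → X)
    (hh : ∀ x ∈ (E.1 : Set X), ∀ y ∈ (E.1 : Set X), dist (h x) (h y) ≤ dist x y) :
    ∃ F : BoundedHyperspace X m l, (F.1 : Set X) = h '' E.1 := by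
  have hl : LipschitzOnWith 1 h (E.1 : Set X) :=
    LipschitzOnWith.of_dist_le_mul fun x hx y hy => by simpa using hh x hx y hy
  refine ⟨⟨⟨⟨h '' E.1, E.1.isCompact.image_of_continuousOn hl.continuousOn⟩,
    E.1.nonempty.image h⟩, (encard_image_le _ _).trans E.2.1, ?_⟩, rfl⟩
  refine (Metric.ediam_le ?_).trans E.2.2
  rintro _ ⟨x, hx, rfl⟩ _ ⟨y, hy, rfl⟩
  refine le_trans ?_ (Metric.edist_le_ediam_of_mem hx hy)
  rw [edist_dist, edist_dist]
  exact ENNReal.ofReal_le_ofReal (hh x hx y hy)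

theorem BoundedHyperspace.dist_le_of_eq_image {E F : BoundedHyperspace X m l} {h : X → X}
    (hF : (F.1 : Set X) = h '' E.1) {r : ℝ} (hr : ∀ x ∈ (E.1 : Set X), dist x (h x) ≤ r) :
    dist E F ≤ r := by
  refine NonemptyCompacts.dist_le_of_forall (fun x hx => ⟨h x, ?_, hr x hx⟩) fun y hy => ?_
  · exact hF ▸ mem_image_of_mem h hx
  · rw [hF] at hy
    obtain ⟨x, hx, rfl⟩ := hy
    exact ⟨x, hx, dist_comm x (h x) ▸ hr x hx⟩

theorem BoundedHyperspace.exists_eq_singleton (hm : 1 ≤ m) (x : X) :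
    ∃ E : BoundedHyperspace X m l, (E.1 : Set X) = {x} :=
  ⟨⟨{x}, by simpa using hm, by simp⟩, rfl⟩

/-- In a space with equidistant extensions, finite sets can be replaced by compact sets, if
one only asks for a lower bound of the distances. -/
theorem HasEquidistantExtension.exists_of_isCompact [IsUltrametricDist X] {R : Set ℝ}
    (hX : HasEquidistantExtension R X) {r : ℝ} (hr : r ∈ R) (hr0 : 0 < r) {K : Set X}
    (hK : IsCompact K) (x : X) : ∃ p, dist p x = r ∧ ∀ y ∈ K, r ≤ dist p y := by
  obtain ⟨t, -, ht, htK⟩ := hK.finite_cover_balls hr0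
  -- Centres outside the closed ball can be dropped: if `p` is within less than `r` of some `y ∈ K`,
  -- the centre covering `y` is that close to `p` too, hence within `r` of `x`.
  obtain ⟨p, hp⟩ := hX r hr hr0 (insert x (t ∩ Metric.closedBall x r))
    ((ht.inter_of_left _).insert x) (by
      have : ∀ y ∈ insert x (t ∩ Metric.closedBall x r), dist y x ≤ r := by
        rintro y (rfl | hy)
        · simpa using hr0.le
        · exact hy.2
      intro y hy z hz
      refine (dist_triangle_max y x z).trans (max_le (this y hy) ?_)
      rw [dist_comm]
      exact this z hz)
  have hpx : dist p x = r := hp x (mem_insert _ _)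
  refine ⟨p, hpx, fun y hy => ?_⟩
  by_contra! hlt
  obtain ⟨z, hz, hyz⟩ := mem_iUnion₂.1 (htK hy)
  have hyz : dist y z < r := hyz
  have hpz : dist p z < r := (dist_triangle_max p y z).trans_lt (max_lt hlt hyz)
  refine hpz.ne (hp z (mem_insert_of_mem _ ⟨hz, ?_⟩))
  refine (dist_triangle_max z p x).trans (max_le ?_ hpx.le)
  rw [dist_comm]
  exact hpz.le

theorem HasEquidistantExtension.boundedHyperspace [IsUltrametricDist X] {R : Set ℝ}
    (hX : HasEquidistantExtension R X) [Nonempty (BoundedHyperspace X m l)] :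
    HasEquidistantExtension R (BoundedHyperspace X m l) := by
  classical
  intro r hr hr0 A hA hAr
  rcases A.eq_empty_or_nonempty with rfl | ⟨E, hE⟩
  · exact ⟨Classical.arbitrary _, by simp⟩
  obtain ⟨e, he⟩ := E.1.nonempty
  obtain ⟨p, hpe, hp⟩ := hX.exists_of_isCompact hr hr0
    (hA.isCompact_biUnion fun F _ => F.1.isCompact) e
  -- If exactly one of two points is within `r` of `p`, their distance equals that of the other
  -- point to `p`; this makes the collapse nonexpanding.
  let h : X → X := fun x => if dist x p ≤ r then p else x
  have h1 : ∀ x, dist x p ≤ r → h x = p := fun x hx => if_pos hx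
  have h2 : ∀ x, ¬ dist x p ≤ r → h x = x := fun x hx => if_neg hx
  obtain ⟨F, hF⟩ := E.exists_image h (by
    intro x _ y _
    by_cases hx : dist x p ≤ r <;> by_cases hy : dist y p ≤ r
    · simp [h1 _ hx, h1 _ hy]
    · rw [h1 _ hx, h2 _ hy, dist_comm]
      have := dist_triangle_max y x p
      rw [dist_comm y x] at this
      grind
    · rw [h2 _ hx, h1 _ hy]
      have := dist_triangle_max x y p
      grind
    · rw [h2 _ hx, h2 _ hy])
  have hEF : dist E F ≤ r := BoundedHyperspace.dist_le_of_eq_image hF fun x _ => by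
    by_cases hx : dist x p ≤ r
    · rwa [h1 _ hx]
    · rw [h2 _ hx, dist_self]
      exact hr0.le
  refine ⟨F, fun G hG => le_antisymm ?_ ?_⟩
  · refine (dist_triangle_max F.1 E.1 G.1).trans (max_le ?_ (hAr E hE G hG))
    rw [dist_comm]
    exact hEF
  · have hpF : p ∈ (F.1 : Set X) := by
      rw [hF]
      exact ⟨e, he, h1 _ (by rw [dist_comm, hpe])⟩
    obtain ⟨y, hy, hpy⟩ := F.1.exists_dist_le G.1 hpF
    exact (hp y (mem_biUnion hG hy)).trans hpy

theorem IsSeparableUrysohnUltrametric.boundedHyperspace {R : Set ℝ} (h0 : 0 ∈ R)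
    (hm : 1 ≤ m) (hX : IsSeparableUrysohnUltrametric R X) :
    IsSeparableUrysohnUltrametric R (BoundedHyperspace X m l) := by
  have := hX.valued.ultra
  have := hX.complete
  have := hX.separable
  have : SecondCountableTopology X := UniformSpace.secondCountable_of_separable X
  obtain ⟨x⟩ := hX.injective.1
  obtain ⟨E, -⟩ := BoundedHyperspace.exists_eq_singleton (l := l) hm x
  have : Nonempty (BoundedHyperspace X m l) := ⟨E⟩
  exact ⟨inferInstance, completeSpace_boundedHyperspace,
    (hX.injective.hasEquidistantExtension h0 hX.valued).boundedHyperspace.isFiniteUltrametricInjective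
      hX.valued.boundedHyperspace, hX.valued.boundedHyperspace⟩

end Hausdorff

theorem IsSeparableUrysohnUltrametric.of_isometryEquiv {R : Set ℝ} {X Y : Type*} [MetricSpace X]
    [MetricSpace Y] (e : X ≃ᵢ Y) (hX : IsSeparableUrysohnUltrametric R X) :
    IsSeparableUrysohnUltrametric R Y := by
  have := hX.separable
  have := hX.complete
  have := hX.valued.ultra
  refine ⟨e.surjective.denseRange.separableSpace e.continuous, e.symm.completeSpace,
    ⟨hX.injective.1.map e, fun A B _ _ _ _ hA hB φ f hφ hf => ?_⟩, ⟨⟨fun x y z => ?_⟩, ?_⟩⟩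
  · obtain ⟨F, hF, hFf⟩ := hX.injective.2 A B hA hB φ (e.symm ∘ f) hφ (e.symm.isometry.comp hf)
    refine ⟨e ∘ F, e.isometry.comp hF, ?_⟩
    rw [Function.comp_assoc, hFf, ← Function.comp_assoc]
    exact funext fun a => e.apply_symm_apply (f a)
  · simpa only [e.symm.dist_eq] using dist_triangle_max (e.symm x) (e.symm y) (e.symm z)
  · intro x y
    simpa only [e.symm.dist_eq] using hX.valued.dist_mem (e.symm x) (e.symm y)

/-! ### Petals and the uncountable case -/

section Petal

variable {X : Type*} [MetricSpace X] {R : Set ℝ} {P : Set ℝ → Set X}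

theorem exists_pos_mem_ne_of_not_countable (hR : IsRangeSet R) (hc : ¬ R.Countable) (r : ℝ) :
    ∃ a ∈ R, 0 < a ∧ a ≠ r := by
  by_contra! h
  refine hc ((Set.toFinite {0, r}).countable.mono fun x hx => ?_)
  rcases (show 0 ≤ x from hR.1 hx).eq_or_lt with h0 | h0
  exacts [Or.inl h0.symm, Or.inr (h x hx h0)]

theorem ne_singleton_zero_of_mem {S : Set ℝ} {a : ℝ} (ha : a ∈ S) (h : 0 < a) : S ≠ {0} := by
  rintro rfl
  exact h.ne' ha

theorem union_mem_tenuousRangeSubsets (hR : IsRangeSet R) {S T : Set ℝ}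
    (hS : S ∈ tenuousRangeSubsets R) (hT : T ∈ tenuousRangeSubsets R) :
    S ∪ T ∈ tenuousRangeSubsets R := by
  rw [mem_tenuousRangeSubsets hR] at *
  exact ⟨Or.inl hS.1, hS.2.1.union hT.2.1, union_subset hS.2.2 hT.2.2⟩

theorem insert_mem_tenuousRangeSubsets (hR : IsRangeSet R) {T : Set ℝ}
    (hT : T ∈ tenuousRangeSubsets R) {r : ℝ} (hr : r ∈ R) :
    insert r T ∈ tenuousRangeSubsets R := by
  rw [mem_tenuousRangeSubsets hR] at *
  exact ⟨Or.inr hT.1, (finite_singleton r).isFiniteAwayFromZero.union hT.2.1,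
    insert_subset hr hT.2.2⟩

theorem IsPetal.mono (hP : IsPetal R X P) {S T : Set ℝ} (hS : S ∈ tenuousRangeSubsets R)
    (hT : T ∈ tenuousRangeSubsets R) (h : S ⊆ T) : P S ⊆ P T := by
  have := hP.inter_eq S hS T hT
  rw [inter_eq_left.2 h] at this
  exact inter_eq_left.1 this

theorem IsPetal.exists_mem (hP : IsPetal R X P) (x : X) :
    ∃ S ∈ tenuousRangeSubsets R, x ∈ P S := by
  simpa using hP.iUnion_eq.ge (mem_univ x)

theorem IsPetal.isComplete (hP : IsPetal R X P) {S : Set ℝ} (hS : S ∈ tenuousRangeSubsets R)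
    (h : S ≠ {0}) : IsComplete (P S) :=
  completeSpace_coe_iff_isComplete.1 (hP.urysohn S hS h).complete

/-- The distance to `P S` is zero or lies in `T \ S`, which has nothing below `δ`; and `P S` is
closed. -/
theorem IsPetal.mem_of_infDist_lt (hP : IsPetal R X P) {S T : Set ℝ}
    (hS : S ∈ tenuousRangeSubsets R) (hS0 : S ≠ {0}) (hT : T ∈ tenuousRangeSubsets R) {x : X}
    (hx : x ∈ P T) {δ : ℝ} (hTS : T ∩ Iio δ ⊆ S) (h : Metric.infDist x (P S) < δ) : x ∈ P S := by
  have hcl := (hP.isComplete hS hS0).isClosed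
  rcases hP.infDist_mem S hS T hT x hx with h0 | h1
  · rw [← hcl.closure_eq]
    exact (Metric.mem_closure_iff_infDist_zero (hP.nonempty S hS)).2 h0
  · exact absurd (hTS ⟨h1.1, h⟩) h1.2

/-- Every totally bounded set is contained in a member of the petal. -/
theorem IsPetal.exists_superset (hP : IsPetal R X P) (hR : IsRangeSet R) (hc : ¬ R.Countable)
    {K : Set X} (hK : TotallyBounded K) : ∃ S ∈ tenuousRangeSubsets R, S ≠ {0} ∧ K ⊆ P S := by
  obtain ⟨a, haR, ha, -⟩ := exists_pos_mem_ne_of_not_countable hR hc 0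
  choose T hT hxT using hP.exists_mem
  have hT' := fun x => (mem_tenuousRangeSubsets hR).1 (hT x)
  choose F hFK hF hKF using fun n : ℕ =>
    Metric.finite_approx_of_totallyBounded hK (1 / ((n : ℝ) + 1)) Nat.one_div_pos_of_nat
  -- A point of `F (n + 1)` is within `1 / (n + 1)` of `F n`, so only its index values below that
  -- bound are needed to force it into `P S`. Hence each `δ > 0` sees values from finitely many
  -- nets. The value `a` ensures `S ≠ {0}`.
  set S₀ : Set ℝ := {0, a} ∪ ⋃ x ∈ F 0, T x
  set S : Set ℝ := S₀ ∪ ⋃ n : ℕ, ⋃ x ∈ F (n + 1), T x ∩ Iio (1 / ((n : ℝ) + 1))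
  have hS₀fin : IsFiniteAwayFromZero S₀ := by
    refine (Set.toFinite _).isFiniteAwayFromZero.union fun δ hδ => ?_
    rw [iUnion₂_inter]
    exact (hF 0).biUnion fun x _ => (hT' x).2.1 δ hδ
  have hSfin : IsFiniteAwayFromZero S := by
    refine hS₀fin.union fun δ hδ => ?_
    obtain ⟨N, hN⟩ := exists_nat_one_div_lt hδ
    refine ((finite_Iio N).biUnion fun n _ => (hF (n + 1)).biUnion fun x _ =>
      (hT' x).2.1 δ hδ).subset ?_
    rintro s ⟨hs, hsδ⟩
    simp only [mem_iUnion, mem_inter_iff, mem_Iio, exists_prop] at hs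
    obtain ⟨n, x, hx, hsx, hsn⟩ := hs
    refine mem_biUnion (x := n) ?_ (mem_biUnion hx ⟨hsx, hsδ⟩)
    by_contra h
    have : (1 : ℝ) / (n + 1) ≤ 1 / (N + 1) := Nat.one_div_le_one_div (not_lt.1 h)
    exact absurd (hsδ.trans_lt (hsn.trans_le this)) hN.not_gt
  have hSR : S ⊆ R := by
    refine union_subset (union_subset ?_ (iUnion₂_subset fun x _ => (hT' x).2.2))
      (iUnion_subset fun n => iUnion₂_subset fun x _ => inter_subset_left.trans (hT' x).2.2)
    rintro s (rfl | rfl)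
    exacts [hR.2, haR]
  have hSt : S ∈ tenuousRangeSubsets R :=
    (mem_tenuousRangeSubsets hR).2 ⟨Or.inl (Or.inl (Or.inl rfl)), hSfin, hSR⟩
  have hS0 : S ≠ {0} := ne_singleton_zero_of_mem (Or.inl (Or.inl (Or.inr rfl))) ha
  have hFS : ∀ n, F n ⊆ P S := by
    intro n
    induction n with
    | zero =>
      refine fun x hx => hP.mono (hT x) hSt (fun s hs => ?_) (hxT x)
      exact Or.inl (Or.inr (mem_biUnion hx hs))
    | succ n ih =>
      intro x hx
      obtain ⟨y, hy, hxy⟩ := mem_iUnion₂.1 (hKF n (hFK (n + 1) hx))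
      refine hP.mem_of_infDist_lt hSt hS0 (hT x) (hxT x) (δ := 1 / ((n : ℝ) + 1)) ?_
        ((Metric.infDist_le_dist_of_mem (ih hy)).trans_lt hxy)
      exact fun s hs => Or.inr (mem_iUnion.2 ⟨n, mem_biUnion hx hs⟩)
  refine ⟨S, hSt, hS0, fun x hx => ?_⟩
  rw [← (hP.isComplete hSt hS0).isClosed.closure_eq, Metric.mem_closure_iff]
  intro ε hε
  obtain ⟨n, hn⟩ := exists_nat_one_div_lt hε
  obtain ⟨y, hy, hxy⟩ := mem_iUnion₂.1 (hKF n hx)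
  exact ⟨y, hFS n hy, hxy.trans hn⟩

/-- A Cauchy sequence has totally bounded range, so it lives in a single complete `P S`. -/
theorem IsPetal.completeSpace (hP : IsPetal R X P) (hR : IsRangeSet R) (hc : ¬ R.Countable) :
    CompleteSpace X := by
  refine Metric.complete_of_cauchySeq_tendsto fun u hu => ?_
  obtain ⟨S, hS, hS0, h⟩ := hP.exists_superset hR hc hu.totallyBounded_range
  obtain ⟨x, -, hx⟩ := cauchySeq_tendsto_of_isComplete (hP.isComplete hS hS0)
    (fun n => h (mem_range_self n)) hu
  exact ⟨x, hx⟩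

variable {m : ℕ∞} {l : ℝ≥0∞}

/-- The bounded hyperspace of a subspace. -/
theorem BoundedHyperspace.nonempty_isometryEquiv_subset (A : Set X) :
    Nonempty (BoundedHyperspace A m l ≃ᵢ {E : BoundedHyperspace X m l | (E.1 : Set X) ⊆ A}) := by
  let f : BoundedHyperspace A m l → {E : BoundedHyperspace X m l | (E.1 : Set X) ⊆ A} :=
    fun E => ⟨⟨E.1.map Subtype.val continuous_subtype_val,
      (encard_image_le _ _).trans E.2.1, (isometry_subtype_coe.ediam_image _).trans_le E.2.2⟩,
      by rintro _ ⟨x, -, rfl⟩; exact x.2⟩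
  have hf : Isometry f := Isometry.of_dist_eq fun E F =>
    Metric.hausdorffDist_image isometry_subtype_coe
  refine ⟨IsometryEquiv.mk (Equiv.ofBijective f ⟨hf.injective, ?_⟩) hf⟩
  rintro ⟨E, hE⟩
  have hEA : (Subtype.val : A → X) '' (Subtype.val ⁻¹' (E.1 : Set X)) = E.1 := by
    rw [Subtype.image_preimage_coe]
    exact inter_eq_right.2 hE
  refine ⟨⟨⟨⟨Subtype.val ⁻¹' (E.1 : Set X),
    Subtype.isCompact_iff.2 (by rw [hEA]; exact E.1.isCompact)⟩, ?_⟩, ?_, ?_⟩, ?_⟩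
  · exact image_nonempty.1 (hEA.symm ▸ E.1.nonempty)
  · rw [NonemptyCompacts.coe_mk, Compacts.coe_mk, ← Subtype.val_injective.encard_image, hEA]
    exact E.2.1
  · rw [NonemptyCompacts.coe_mk, Compacts.coe_mk, ← isometry_subtype_coe.ediam_image, hEA]
    exact E.2.2
  · exact Subtype.ext (Subtype.ext (NonemptyCompacts.ext hEA))

theorem IsPetal.infDist_boundedHyperspace [IsUltrametricDist X] {A : Set X} (hA : A.Nonempty)
    (hm : 1 ≤ m) (E : BoundedHyperspace X m l) :
    ∃ x ∈ (E.1 : Set X), Metric.infDist E {F : BoundedHyperspace X m l | (F.1 : Set X) ⊆ A} =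
      Metric.infDist x A := by
  obtain ⟨x, hx, hmax⟩ := E.1.isCompact.exists_isMaxOn E.1.nonempty
    (Metric.continuous_infDist_pt A).continuousOn
  refine ⟨x, hx, le_antisymm ?_ ?_⟩
  -- The slack `η` is there because no nearest point of `A` is assumed to exist.
  · refine le_of_forall_pos_le_add fun η hη => ?_
    set ε := Metric.infDist x A + η
    -- The choice depends on the ball as a set, so points closer than `ε` share their image; this
    -- makes the displacement nonexpanding.
    have hch : ∀ U : Set X, ∃ y, (U ∩ A).Nonempty → y ∈ U ∩ A := by
      intro U
      by_cases hU : (U ∩ A).Nonempty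
      · exact ⟨hU.some, fun _ => hU.some_mem⟩
      · exact ⟨x, fun h => absurd h hU⟩
    choose f hf using hch
    have hfE : ∀ y ∈ (E.1 : Set X), f (Metric.ball y ε) ∈ Metric.ball y ε ∩ A := by
      intro y hy
      obtain ⟨z, hz, hyz⟩ := (Metric.infDist_lt_iff hA).1
        ((hmax hy : Metric.infDist y A ≤ Metric.infDist x A).trans_lt (lt_add_of_pos_right _ hη))
      exact hf _ ⟨z, by rwa [Metric.mem_ball, dist_comm], hz⟩
    have hfd : ∀ y ∈ (E.1 : Set X), dist y (f (Metric.ball y ε)) < ε := fun y hy => by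
      rw [dist_comm]
      exact (hfE y hy).1
    obtain ⟨F, hF⟩ := E.exists_image (fun y => f (Metric.ball y ε)) (by
      intro y hy z hz
      by_cases hyz : dist y z < ε
      · rw [IsUltrametricDist.ball_eq_of_mem (show y ∈ Metric.ball z ε from hyz), dist_self]
        exact dist_nonneg
      · rw [not_lt] at hyz
        have h1 := hfd y hy
        have h2 := hfd z hz
        refine (dist_triangle_max _ y _).trans (max_le ?_ ((dist_triangle_max _ z _).trans
          (max_le le_rfl (h2.le.trans hyz))))
        rw [dist_comm]
        exact h1.le.trans hyz)
    refine (Metric.infDist_le_dist_of_mem (y := F) ?_).trans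
      (BoundedHyperspace.dist_le_of_eq_image hF fun y hy => (hfd y hy).le)
    change (F.1 : Set X) ⊆ A
    rw [hF]
    rintro _ ⟨y, hy, rfl⟩
    exact (hfE y hy).2
  · obtain ⟨a, ha⟩ := hA
    obtain ⟨F, hF⟩ := BoundedHyperspace.exists_eq_singleton (l := l) hm a
    refine (Metric.le_infDist ⟨F, by simpa [hF] using ha⟩).2 fun G hG => ?_
    obtain ⟨y, hy, hxy⟩ := E.1.exists_dist_le G.1 hx
    exact (Metric.infDist_le_dist_of_mem (hG hy)).trans hxy

theorem IsPetal.boundedHyperspace [IsUltrametricDist X] (hP : IsPetal R X P) (hR : IsRangeSet R)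
    (hc : ¬ R.Countable) (hm : 1 ≤ m) :
    IsPetal R (BoundedHyperspace X m l)
      (fun S => {E : BoundedHyperspace X m l | (E.1 : Set X) ⊆ P S}) := by
  refine ⟨fun S hS => ?_, fun S hS hS0 => ?_, ?_, fun S hS T hT => ?_, fun S hS T hT E hE => ?_⟩
  · obtain ⟨x, hx⟩ := hP.nonempty S hS
    obtain ⟨E, hE⟩ := BoundedHyperspace.exists_eq_singleton (l := l) hm x
    exact ⟨E, by simpa [hE] using hx⟩
  · obtain ⟨e⟩ := BoundedHyperspace.nonempty_isometryEquiv_subset (m := m) (l := l) (P S)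
    exact ((hP.urysohn S hS hS0).boundedHyperspace hS.1.2 hm).of_isometryEquiv e
  · refine eq_univ_of_forall fun E => ?_
    obtain ⟨S, hS, -, h⟩ := hP.exists_superset hR hc E.1.isCompact.totallyBounded
    exact mem_biUnion hS h
  · ext E
    simp [← hP.inter_eq S hS T hT]
  · obtain ⟨x, hx, h⟩ := IsPetal.infDist_boundedHyperspace (hP.nonempty S hS) hm E
    exact h ▸ hP.infDist_mem S hS T hT x (hE hx)

end Petal

/-! ### Coordinates and uniqueness -/

section Coordinates

variable {X Y : Type*} [MetricSpace X] [MetricSpace Y] {R : Set ℝ}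

/-- `L` identifies `X` with the space of all functions `f : ℝ → ℕ` whose support consists of
positive elements of `R` and is finite away from zero, in such a way that the distance of two
points is the largest number at which their coordinates differ. -/
structure IsCoordinates (R : Set ℝ) (L : X → ℝ → ℕ) : Prop where
  eq_of_dist_lt : ∀ x y r, dist x y < r → L x r = L y r
  ne_of_dist_pos : ∀ x y, 0 < dist x y → L x (dist x y) ≠ L y (dist x y)
  range_eq : range L =
    {f | Function.support f ⊆ R ∩ Ioi 0 ∧ IsFiniteAwayFromZero (Function.support f)}

theorem IsCoordinates.injective {L : X → ℝ → ℕ} (hL : IsCoordinates R L) :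
    Function.Injective L := by
  intro x y h
  by_contra hne
  exact hL.ne_of_dist_pos x y (dist_pos.2 hne) (congrFun h _)

theorem IsCoordinates.dist_le_of_eq {L : X → ℝ → ℕ} {M : Y → ℝ → ℕ} (hL : IsCoordinates R L)
    (hM : IsCoordinates R M) {x y : X} {x' y' : Y} (hx : M x' = L x) (hy : M y' = L y) :
    dist x y ≤ dist x' y' := by
  by_contra! h
  refine hL.ne_of_dist_pos x y (dist_nonneg.trans_lt h) ?_
  rw [← hx, ← hy]
  exact hM.eq_of_dist_lt _ _ _ h

/-- Distances can be read off from coordinates, and the range of the coordinates depends only on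
`R`; matching coordinates is therefore an isometry. -/
theorem IsCoordinates.nonempty_isometryEquiv {L : X → ℝ → ℕ} {M : Y → ℝ → ℕ}
    (hL : IsCoordinates R L) (hM : IsCoordinates R M) : Nonempty (X ≃ᵢ Y) := by
  have h : ∀ x, ∃ y, M y = L x := fun x => (hM.range_eq.trans hL.range_eq.symm).ge ⟨x, rfl⟩
  choose f hf using h
  have hfi : Isometry f := Isometry.of_dist_eq fun x y =>
    le_antisymm (hM.dist_le_of_eq hL (hf x).symm (hf y).symm) (hL.dist_le_of_eq hM (hf x) (hf y))
  refine ⟨IsometryEquiv.mk (Equiv.ofBijective f ⟨hfi.injective, fun y => ?_⟩) hfi⟩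
  obtain ⟨x, hx⟩ := (hM.range_eq.trans hL.range_eq.symm).le ⟨y, rfl⟩
  exact ⟨x, hM.injective ((hf x).trans hx)⟩

theorem Set.Countable.exists_bijOn_nat {α : Type*} {s : Set α} (hs : s.Countable)
    (hi : s.Infinite) {a : α} (ha : a ∈ s) : ∃ e : α → ℕ, BijOn e s univ ∧ e a = 0 := by
  classical
  obtain ⟨_⟩ := countable_infinite_iff_nonempty_denumerable.1 ⟨hs, hi⟩
  let e := (Denumerable.eqv s).trans (Equiv.swap (Denumerable.eqv s ⟨a, ha⟩) 0)
  have he : ∀ u (hu : u ∈ s), (if h : u ∈ s then e ⟨u, h⟩ else 0) = e ⟨u, hu⟩ :=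
    fun u hu => dif_pos hu
  refine ⟨fun u => if h : u ∈ s then e ⟨u, h⟩ else 0, ⟨fun _ _ => trivial, ?_, ?_⟩, ?_⟩
  · intro u hu v hv h
    simp only [he u hu, he v hv] at h
    exact congrArg Subtype.val (e.injective h)
  · intro n _
    refine ⟨e.symm n, (e.symm n).2, ?_⟩
    exact (he _ (e.symm n).2).trans (e.apply_symm_apply n)
  · simp only [he a ha]
    exact Equiv.swap_apply_left _ _

/-- Labels for the open balls of radius `r` in a closed ball of radius `r`, with prescribed
balls labelled by zero. -/
theorem exists_labelling (hX : IsValuedUltrametric R X)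
    (hcount : ∀ x : X, ∀ r ∈ R, 0 < r →
      ((fun y => Metric.ball y r) '' Metric.closedBall x r).Countable)
    (hinf : ∀ x : X, ∀ r ∈ R, 0 < r →
      ((fun y => Metric.ball y r) '' Metric.closedBall x r).Infinite)
    (c : X → ℝ → X) (hc : ∀ x, ∀ r ∈ R, 0 < r → dist x (c x r) ≤ r)
    (hcc : ∀ x y, ∀ r ∈ R, 0 < r → dist x y ≤ r → dist (c x r) (c y r) < r) :
    ∃ L : X → ℝ → ℕ, (∀ x y r, dist x y < r → L x r = L y r) ∧
      (∀ x y, 0 < dist x y → L x (dist x y) ≠ L y (dist x y)) ∧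
      (∀ x, Function.support (L x) ⊆ R ∩ Ioi 0) ∧
      (∀ x, ∀ r ∈ R, 0 < r → (L x r = 0 ↔ dist x (c x r) < r)) ∧
      ∀ x, ∀ r ∈ R, 0 < r → ∀ n, ∃ y, dist x y ≤ r ∧ L y r = n := by
  classical
  have := hX.ultra
  -- The labelling is chosen per closed ball as a set, so points within `r` of each other use the
  -- same one.
  have hch : ∀ (C : Set X) (r : ℝ), ∃ e : Set X → ℕ, ∀ x, r ∈ R → 0 < r →
      C = Metric.closedBall x r →
      BijOn e ((fun y => Metric.ball y r) '' C) univ ∧ e (Metric.ball (c x r) r) = 0 := by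
    intro C r
    by_cases h : ∃ x, r ∈ R ∧ 0 < r ∧ C = Metric.closedBall x r
    · obtain ⟨x, hr, hr0, rfl⟩ := h
      obtain ⟨e, he, he0⟩ := (hcount x r hr hr0).exists_bijOn_nat (hinf x r hr hr0)
        (mem_image_of_mem _ (by rw [Metric.mem_closedBall, dist_comm]; exact hc x r hr hr0))
      refine ⟨e, fun y _ _ hxy => ⟨he, ?_⟩⟩
      have hyx : dist y x ≤ r := by
        rw [← Metric.mem_closedBall, hxy]
        exact Metric.mem_closedBall_self hr0.le
      rwa [IsUltrametricDist.ball_eq_of_mem (show c y r ∈ Metric.ball (c x r) r from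
        hcc y x r hr hr0 hyx)] at he0
    · exact ⟨fun _ => 0, fun x hr hr0 hC => absurd ⟨x, hr, hr0, hC⟩ h⟩
  choose e he using hch
  have hbij := fun x r hr hr0 => (he (Metric.closedBall x r) r x hr hr0 rfl).1
  have hzero := fun x r hr hr0 => (he (Metric.closedBall x r) r x hr hr0 rfl).2
  let L : X → ℝ → ℕ := fun x r =>
    if r ∈ R ∧ 0 < r then e (Metric.closedBall x r) r (Metric.ball x r) else 0
  have hL : ∀ x, ∀ r ∈ R, 0 < r → L x r = e (Metric.closedBall x r) r (Metric.ball x r) :=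
    fun x r hr hr0 => if_pos ⟨hr, hr0⟩
  have hcb : ∀ {x y : X} {r : ℝ}, dist x y ≤ r → Metric.closedBall y r = Metric.closedBall x r :=
    fun h => IsUltrametricDist.closedBall_eq_of_mem h
  have hb : ∀ {x y : X} {r : ℝ}, dist x y < r → Metric.ball y r = Metric.ball x r :=
    fun h => IsUltrametricDist.ball_eq_of_mem h
  have hbm : ∀ {x y : X} {r : ℝ}, dist y x ≤ r →
      Metric.ball y r ∈ (fun y => Metric.ball y r) '' Metric.closedBall x r :=
    fun h => mem_image_of_mem _ h
  have hdist : ∀ {x y : X} {r : ℝ}, 0 < r → Metric.ball x r = Metric.ball y r → dist x y < r :=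
    fun hr h => by
      rw [← Metric.mem_ball, ← h]
      exact Metric.mem_ball_self hr
  refine ⟨L, fun x y r h => ?_, fun x y h => ?_, fun x r hr => ?_, fun x r hr hr0 => ?_,
    fun x r hr hr0 n => ?_⟩
  · simp only [L, hcb h.le, hb h]
  · have hr := hX.dist_mem x y
    rw [hL _ _ hr h, hL _ _ hr h, hcb le_rfl]
    intro heq
    refine (hdist h ((hbij x _ hr h).injOn (hbm ?_) (hbm ?_) heq)).ne rfl
    · rw [dist_self]
      exact h.le
    · rw [dist_comm]
  · by_contra h
    exact hr (if_neg h)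
  · rw [hL _ _ hr hr0, ← hzero x r hr hr0]
    refine ⟨fun h => hdist hr0 ((hbij x _ hr hr0).injOn (hbm ?_) (hbm ?_) h), fun h => ?_⟩
    · rw [dist_self]
      exact hr0.le
    · rw [dist_comm]
      exact hc x r hr hr0
    · rw [hb h]
  · obtain ⟨_, ⟨y, hy, rfl⟩, h⟩ := (hbij x r hr hr0).surjOn (mem_univ n)
    have hxy : dist x y ≤ r := by rwa [dist_comm]
    exact ⟨y, hxy, by rwa [hL _ _ hr hr0, hcb hxy]⟩

/-- Only surjectivity is at stake. Truncations of `f` are realized coordinate by coordinate, and the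
realizing points converge to a point with coordinates `f`. -/
theorem isCoordinates_of_exists [CompleteSpace X] {L : X → ℝ → ℕ}
    (hlt : ∀ x y r, dist x y < r → L x r = L y r)
    (hne : ∀ x y, 0 < dist x y → L x (dist x y) ≠ L y (dist x y))
    (hsupp : ∀ x, Function.support (L x) ⊆ R ∩ Ioi 0)
    (hfin : ∀ x, IsFiniteAwayFromZero (Function.support (L x)))
    (hzero : ∃ x, L x = 0)
    (hstep : ∀ x, ∀ r ∈ R, 0 < r → ∀ n, ∃ y, dist x y ≤ r ∧ L y r = n ∧
      ∀ s ∈ R, 0 < s → s < r → L y s = 0) :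
    IsCoordinates R L := by
  classical
  refine ⟨hlt, hne, Subset.antisymm (range_subset_iff.2 fun x => ⟨hsupp x, hfin x⟩) ?_⟩
  rintro f ⟨hfR, hff⟩
  have hfinite : ∀ A : Finset ℝ, (A : Set ℝ) ⊆ R ∩ Ioi 0 →
      ∃ x, ∀ r, L x r = if r ∈ A then f r else 0 := by
    intro A
    -- Coordinates are set from the largest down: a move by at most `a` keeps those above `a`.
    induction A using Finset.induction_on_min with
    | empty =>
      obtain ⟨x, hx⟩ := hzero
      exact fun _ => ⟨x, fun r => by simp [hx]⟩
    | insert a A hmin ih =>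
      intro hA
      rw [Finset.coe_insert, insert_subset_iff] at hA
      obtain ⟨x, hx⟩ := ih hA.2
      obtain ⟨y, hxy, hya, hy⟩ := hstep x a hA.1.1 hA.1.2 (f a)
      refine ⟨y, fun r => ?_⟩
      rcases lt_trichotomy r a with h | rfl | h
      · rw [if_neg]
        · by_contra h0
          exact h0 (hy r (hsupp y h0).1 (hsupp y h0).2 h)
        · rw [Finset.mem_insert, not_or]
          exact ⟨h.ne, fun hr => (hmin r hr).not_gt h⟩
      · simp [hya]
      · rw [← hlt x y r (hxy.trans_lt h), hx]
        simp [h.ne']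
  have happrox : ∀ n : ℕ, ∃ x, ∀ r, 1 / ((n : ℝ) + 1) ≤ r → L x r = f r := by
    intro n
    have hA := hff (1 / ((n : ℝ) + 1)) Nat.one_div_pos_of_nat
    obtain ⟨x, hx⟩ := hfinite hA.toFinset (by
      rw [hA.coe_toFinset]
      exact inter_subset_left.trans hfR)
    refine ⟨x, fun r hr => ?_⟩
    rw [hx]
    by_cases h : f r = 0
    · simp [h]
    · exact if_pos (hA.mem_toFinset.2 ⟨h, hr⟩)
  choose x hx using happrox
  have hdist : ∀ N n, N ≤ n → dist (x n) (x N) < 1 / ((N : ℝ) + 1) := by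
    intro N n hn
    by_contra! h
    refine hne (x n) (x N) (Nat.one_div_pos_of_nat.trans_le h) ?_
    rw [hx N _ h, hx n _ ((Nat.one_div_le_one_div hn).trans h)]
  have hcauchy : CauchySeq x := by
    refine Metric.cauchySeq_iff'.2 fun ε hε => ?_
    obtain ⟨N, hN⟩ := exists_nat_one_div_lt hε
    exact ⟨N, fun n hn => (hdist N n hn).trans hN⟩
  obtain ⟨y, hy⟩ := cauchySeq_tendsto_of_complete hcauchy
  refine ⟨y, funext fun r => ?_⟩
  rcases le_or_gt r 0 with hr | hr
  · have h1 : f r = 0 := by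
      by_contra h
      exact (hfR h).2.not_ge hr
    have h2 : L y r = 0 := by
      by_contra h
      exact (hsupp y h).2.not_ge hr
    rw [h1, h2]
  · obtain ⟨N, hN⟩ := exists_nat_one_div_lt hr
    obtain ⟨M, hM⟩ := Metric.tendsto_atTop.1 hy r hr
    rw [← hlt _ _ _ (hM (max N M) (le_max_right _ _))]
    exact hx _ _ ((Nat.one_div_le_one_div (le_max_left _ _)).trans hN.le)

/-- A point at distance `r` from `x` and from representatives of finitely many balls lies in a
further ball. -/
theorem HasEquidistantExtension.infinite_image_ball [IsUltrametricDist X]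
    (hX : HasEquidistantExtension R X) (x : X) {r : ℝ} (hr : r ∈ R) (hr0 : 0 < r) :
    ((fun y => Metric.ball y r) '' Metric.closedBall x r).Infinite := by
  intro hfin
  obtain ⟨A, hA, hbij⟩ := exists_subset_bijOn (Metric.closedBall x r) fun y => Metric.ball y r
  have hle : ∀ y ∈ insert x A, dist y x ≤ r := by
    rintro y (rfl | hy)
    · simpa using hr0.le
    · exact hA hy
  obtain ⟨p, hp⟩ := hX r hr hr0 (insert x A) ((hbij.finite_iff_finite.2 hfin).insert x) (by
    intro y hy z hz
    refine (dist_triangle_max y x z).trans (max_le (hle y hy) ?_)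
    rw [dist_comm]
    exact hle z hz)
  obtain ⟨a, ha, hpa⟩ := hbij.surjOn
    (mem_image_of_mem _ (show p ∈ Metric.closedBall x r from (hp x (mem_insert _ _)).le))
  refine (hp a (mem_insert_of_mem _ ha)).not_lt ?_
  rw [← Metric.mem_ball, show Metric.ball a r = Metric.ball p r from hpa]
  exact Metric.mem_ball_self hr0

theorem IsSeparableUrysohnUltrametric.exists_isCoordinates (h0 : 0 ∈ R)
    (hX : IsSeparableUrysohnUltrametric R X) : ∃ L : X → ℝ → ℕ, IsCoordinates R L := by
  have := hX.valued.ultra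
  have := hX.complete
  have := hX.separable
  have := hX.injective.1
  let u := denseSeq X
  have hu : ∀ (x : X) (r : ℝ), 0 < r → ∃ n, dist x (u n) < r := fun x r hr =>
    (denseRange_denseSeq X).exists_dist_lt x hr
  -- The zero label goes to the ball of the first dense point within `r`. For `r ≥ δ` this index is
  -- bounded, and a nonzero label forces `r` to be the distance from `x` to that point, so few `r`
  -- occur.
  let k : X → ℝ → ℕ := fun x r => sInf {n | dist x (u n) ≤ r}
  have hk : ∀ x r, 0 < r → dist x (u (k x r)) ≤ r := fun x r hr =>
    Nat.sInf_mem (s := {n | dist x (u n) ≤ r}) ((hu x r hr).imp fun _ h => h.le)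
  have hkle : ∀ {x r n}, dist x (u n) ≤ r → k x r ≤ n := fun h => Nat.sInf_le h
  obtain ⟨L, hlt, hne, hsupp, hLc, hsurj⟩ := exists_labelling hX.valued
    (fun x r _ hr => (countable_range fun n => Metric.ball (u n) r).mono (by
      rintro _ ⟨y, -, rfl⟩
      obtain ⟨n, hn⟩ := hu y r hr
      exact ⟨n, IsUltrametricDist.ball_eq_of_mem hn⟩))
    (fun x r hr hr0 =>
      (hX.injective.hasEquidistantExtension h0 hX.valued).infinite_image_ball x hr hr0)
    (fun x r => u (k x r)) (fun x r _ hr => hk x r hr) (by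
      intro x y r _ hr hxy
      have : k x r = k y r := by
        refine le_antisymm (hkle ?_) (hkle ?_)
        · exact (dist_triangle_max x y _).trans (max_le hxy (hk y r hr))
        · rw [dist_comm] at hxy
          exact (dist_triangle_max y x _).trans (max_le hxy (hk x r hr))
      rwa [this, dist_self])
  have hLu : ∀ j, (∀ s ∈ R, 0 < s → k (u j) s = j → L (u j) s = 0) := by
    intro j s hs hs0 h
    rw [hLc _ _ hs hs0, h, dist_self]
    exact hs0
  refine ⟨L, isCoordinates_of_exists hlt hne hsupp (fun x δ hδ => ?_) ⟨u 0, ?_⟩ ?_⟩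
  · obtain ⟨n, hn⟩ := hu x δ hδ
    refine ((finite_Iic n).image fun j => dist x (u j)).subset ?_
    rintro r ⟨hr, hδr⟩
    obtain ⟨hrR, hr0⟩ := hsupp x hr
    refine ⟨k x r, hkle (hn.le.trans hδr), le_antisymm (hk x r hr0) (not_lt.1 fun h => ?_)⟩
    exact hr ((hLc x r hrR hr0).2 h)
  · funext s
    by_contra h
    obtain ⟨hs, hs0⟩ := hsupp _ h
    refine h (hLu 0 s hs hs0 (Nat.le_zero.1 (hkle ?_)))
    rw [dist_self]
    exact (show 0 < s from hs0).le
  · intro x r hr hr0 n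
    obtain ⟨y, hxy, hy⟩ := hsurj x r hr hr0 n
    -- By minimality of `j`, for `s < r` no earlier dense point is within `s` of `u j`; thus `u j`
    -- is its own centre and its labels below `r` vanish.
    let j := sInf {i | dist y (u i) < r}
    have hj : dist y (u j) < r := Nat.sInf_mem (s := {i | dist y (u i) < r}) (hu y r hr0)
    refine ⟨u j, (dist_triangle_max x y _).trans (max_le hxy hj.le),
      (hlt _ _ _ hj).symm.trans hy, fun s hs hs0 hsr => hLu j s hs hs0 (le_antisymm (hkle ?_) ?_)⟩
    · rw [dist_self]
      exact hs0.le
    · exact Nat.sInf_le ((dist_triangle_max y (u j) _).trans_lt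
        (max_lt hj ((hk _ _ hs0).trans_lt hsr)))

variable {P : Set ℝ → Set X}

/-- Enlarging `S` by a positive value other than `dist x y` also covers `S = {0}`, about which the
Urysohn clause is silent. -/
theorem IsPetal.dist_mem (hP : IsPetal R X P) (hR : IsRangeSet R) (hc : ¬ R.Countable)
    {S : Set ℝ} (hS : S ∈ tenuousRangeSubsets R) {x y : X} (hx : x ∈ P S) (hy : y ∈ P S) :
    dist x y ∈ S := by
  obtain ⟨a, haR, ha, hne⟩ := exists_pos_mem_ne_of_not_countable hR hc (dist x y)
  have hT := insert_mem_tenuousRangeSubsets hR hS haR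
  have hST := hP.mono hS hT (subset_insert a S)
  have := (hP.urysohn _ hT (ne_singleton_zero_of_mem (mem_insert a S) ha)).valued.dist_mem
    ⟨x, hST hx⟩ ⟨y, hST hy⟩
  exact this.resolve_left fun h => hne h.symm

theorem IsPetal.hasEquidistantExtension (hP : IsPetal R X P) (hR : IsRangeSet R)
    (hc : ¬ R.Countable) : HasEquidistantExtension R X := by
  intro r hr hr0 A hA hAr
  obtain ⟨S, hS, -, hAS⟩ := hP.exists_superset hR hc hA.totallyBounded
  have hT := insert_mem_tenuousRangeSubsets hR hS hr
  have hST := hP.mono hS hT (subset_insert r S)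
  have hU := hP.urysohn _ hT (ne_singleton_zero_of_mem (mem_insert r S) hr0)
  obtain ⟨p, hp⟩ := hU.injective.hasEquidistantExtension hT.1.2 hU.valued r (mem_insert r S) hr0
    (Subtype.val ⁻¹' A) (hA.preimage Subtype.val_injective.injOn)
    (fun x hx y hy => hAr x hx y hy)
  exact ⟨p, fun x hx => hp ⟨x, hST (hAS hx)⟩ hx⟩

theorem IsPetal.exists_dist_lt (hP : IsPetal R X P) {S T : Set ℝ}
    (hS : S ∈ tenuousRangeSubsets R) (hT : T ∈ tenuousRangeSubsets R) {x : X} (hx : x ∈ P T)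
    {r : ℝ} (hr : 0 < r) (h : T \ S ⊆ Iio r) : ∃ y ∈ P S, dist x y < r := by
  refine (Metric.infDist_lt_iff (hP.nonempty S hS)).1 ?_
  rcases hP.infDist_mem S hS T hT x hx with h1 | h1
  · rw [mem_singleton_iff.1 h1]
    exact hr
  · exact h h1

/-- If all distances exceeded `r`, they would lie in the finite part of `T ∪ S` above `r`, so the
infimum would be attained. -/
theorem IsPetal.exists_dist_le (hP : IsPetal R X P) (hR : IsRangeSet R) (hc : ¬ R.Countable)
    {S T : Set ℝ} (hS : S ∈ tenuousRangeSubsets R) (hT : T ∈ tenuousRangeSubsets R) {x : X}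
    (hx : x ∈ P T) {r : ℝ} (hr : 0 < r) (h : T \ S ⊆ Iic r) : ∃ y ∈ P S, dist x y ≤ r := by
  by_contra! hlt
  have hU := union_mem_tenuousRangeSubsets hR hT hS
  have hfin : (dist x '' P S).Finite := by
    refine (((mem_tenuousRangeSubsets hR).1 hU).2.1 r hr).subset ?_
    rintro _ ⟨y, hy, rfl⟩
    exact ⟨hP.dist_mem hR hc hU (hP.mono hT hU subset_union_left hx)
      (hP.mono hS hU subset_union_right hy), (hlt y hy).le⟩
  obtain ⟨_, ⟨y, hy, rfl⟩, hmin⟩ :=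
    Set.exists_min_image _ id hfin ((hP.nonempty S hS).image (dist x))
  have h1 : dist x y ≤ Metric.infDist x (P S) :=
    (Metric.le_infDist (hP.nonempty S hS)).2 fun z hz => hmin _ (mem_image_of_mem _ hz)
  have h2 : Metric.infDist x (P S) ≤ r := by
    rcases hP.infDist_mem S hS T hT x hx with h3 | h3
    · rw [mem_singleton_iff.1 h3]
      exact hr.le
    · exact h h3
  exact (hlt y hy).not_ge (h1.trans h2)

theorem IsPetal.exists_isCoordinates (hX : IsValuedUltrametric R X) (hP : IsPetal R X P)
    (hR : IsRangeSet R) (hc : ¬ R.Countable) : ∃ L : X → ℝ → ℕ, IsCoordinates R L := by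
  have := hX.ultra
  have := hP.completeSpace hR hc
  choose T hT hxT using hP.exists_mem
  have hT' := fun x => (mem_tenuousRangeSubsets hR).1 (hT x)
  -- The zero label at `r` goes to the ball of a point whose index set omits `r`. Two such points
  -- within `r` are closer than `r`, since their distance lies in the union of their index sets.
  have hcenter : ∀ (x : X) (r : ℝ), ∃ y, r ∈ R → 0 < r →
      dist x y ≤ r ∧ ∃ S ∈ tenuousRangeSubsets R, r ∉ S ∧ y ∈ P S := by
    intro x r
    by_cases hr : 0 < r
    · have hS : T x \ {r} ∈ tenuousRangeSubsets R := (mem_tenuousRangeSubsets hR).2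
        ⟨⟨(hT' x).1, hr.ne⟩, (hT' x).2.1.mono sdiff_subset, sdiff_subset.trans (hT' x).2.2⟩
      obtain ⟨y, hy, hxy⟩ := hP.exists_dist_le hR hc hS (hT x) (hxT x) hr (by
        rintro s ⟨hs, hs'⟩
        by_contra h
        exact hs' ⟨hs, fun h' => h (mem_singleton_iff.1 h').le⟩)
      exact ⟨y, fun _ _ => ⟨hxy, _, hS, fun h => h.2 rfl, hy⟩⟩
    · exact ⟨x, fun _ h => absurd h hr⟩
  choose c hc' using hcenter
  have hne : ∀ {x y : X} {S S' : Set ℝ} {r : ℝ}, S ∈ tenuousRangeSubsets R →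
      S' ∈ tenuousRangeSubsets R → x ∈ P S → y ∈ P S' → r ∉ S → r ∉ S' → dist x y ≤ r →
      dist x y < r := by
    intro x y S S' r hS hS' hx hy hrS hrS' h
    have hU := union_mem_tenuousRangeSubsets hR hS hS'
    have := hP.dist_mem hR hc hU (hP.mono hS hU subset_union_left hx)
      (hP.mono hS' hU subset_union_right hy)
    refine lt_of_le_of_ne h fun heq => ?_
    rw [heq] at this
    exact this.elim hrS hrS'
  obtain ⟨L, hlt, hne', hsupp, hLc, hsurj⟩ := exists_labelling hX
    (by
      intro x r hr hr0
      have hU := insert_mem_tenuousRangeSubsets hR (hT x) hr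
      have := (hP.urysohn _ hU (ne_singleton_zero_of_mem (mem_insert r _) hr0)).separable
      obtain ⟨D, hD, hPD⟩ := IsSeparable.of_subtype (P (insert r (T x)))
      refine (hD.image fun y => Metric.ball y r).mono ?_
      rintro _ ⟨y, hy, rfl⟩
      -- The distance is at most `r` and cannot equal `r`, which belongs to the index set. So every
      -- open ball in question meets one separable subspace.
      have hlt : Metric.infDist y (P (insert r (T x))) < r := by
        refine lt_of_le_of_ne ((Metric.infDist_le_dist_of_mem
          (hP.mono (hT x) hU (subset_insert _ _) (hxT x))).trans hy) fun h => ?_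
        rcases hP.infDist_mem _ hU _ (hT y) y (hxT y) with h1 | h1
        · exact hr0.ne' (h.symm.trans h1)
        · rw [h] at h1
          exact h1.2 (mem_insert _ _)
      obtain ⟨z, hz, hyz⟩ := (Metric.infDist_lt_iff (hP.nonempty _ hU)).1 hlt
      obtain ⟨w, hw, hzw⟩ := Metric.mem_closure_iff.1 (hPD hz) r hr0
      exact ⟨w, hw, IsUltrametricDist.ball_eq_of_mem (show y ∈ Metric.ball w r from
        (dist_triangle_max y z w).trans_lt (max_lt hyz hzw))⟩)
    (fun x r hr hr0 => (hP.hasEquidistantExtension hR hc).infinite_image_ball x hr hr0)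
    c (fun x r hr hr0 => (hc' x r hr hr0).1)
    (by
      intro x y r hr hr0 hxy
      obtain ⟨hx, S, hS, hrS, hxS⟩ := hc' x r hr hr0
      obtain ⟨hy, S', hS', hrS', hyS'⟩ := hc' y r hr hr0
      refine hne hS hS' hxS hyS' hrS hrS' ?_
      rw [dist_comm] at hx
      exact (dist_triangle_max _ x _).trans (max_le hx ((dist_triangle_max _ y _).trans
        (max_le hxy hy))))
  have hL0 : ∀ {x : X} {S : Set ℝ}, S ∈ tenuousRangeSubsets R → x ∈ P S → ∀ r ∉ S, L x r = 0 := by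
    intro x S hS hx r hrS
    by_contra h
    obtain ⟨hr, hr0⟩ := hsupp x h
    obtain ⟨hxc, S', hS', hrS', hcS'⟩ := hc' x r hr hr0
    exact h ((hLc x r hr hr0).2 (hne hS hS' hx hcS' hrS hrS' hxc))
  refine ⟨L, isCoordinates_of_exists hlt hne' hsupp (fun x => (hT' x).2.1.mono fun r hr => ?_)
    ?_ ?_⟩
  · by_contra h
    exact hr (hL0 (hT x) (hxT x) r h)
  · have hS : {0} ∈ tenuousRangeSubsets R := (mem_tenuousRangeSubsets hR).2
      ⟨rfl, (finite_singleton 0).isFiniteAwayFromZero, singleton_subset_iff.2 hR.2⟩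
    obtain ⟨x, hx⟩ := hP.nonempty _ hS
    refine ⟨x, funext fun r => ?_⟩
    by_contra h
    exact h (hL0 hS hx r fun h' => (hsupp x h).2.ne' h')
  · intro x r hr hr0 n
    obtain ⟨y, hxy, hy⟩ := hsurj x r hr hr0 n
    -- Deleting the index values below `r` gives a point `z` closer than `r` to `y`: the label at
    -- `r` survives and those below vanish.
    have hS : insert r (insert 0 (T y ∩ Ici r)) ∈ tenuousRangeSubsets R := by
      refine insert_mem_tenuousRangeSubsets hR ((mem_tenuousRangeSubsets hR).2 ⟨mem_insert _ _, ?_,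
        insert_subset hR.2 (inter_subset_left.trans (hT' y).2.2)⟩) hr
      exact (hT' y).2.1.mono (insert_subset (hT' y).1 inter_subset_left)
    obtain ⟨z, hz, hyz⟩ := hP.exists_dist_lt hS (hT y) (hxT y) hr0 (by
      rintro s ⟨hs, hs'⟩
      by_contra h
      exact hs' (Or.inr (Or.inr ⟨hs, mem_Ici.2 (not_lt.1 h)⟩)))
    refine ⟨z, (dist_triangle_max x y z).trans (max_le hxy hyz.le),
      (hlt _ _ _ hyz).symm.trans hy, fun s _ hs0 hsr => hL0 hS hz s ?_⟩
    rintro (h | h | h)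
    · exact hsr.ne h
    · exact hs0.ne' h
    · exact hsr.not_ge h.2

theorem IsUrysohnUniversalUltrametric.exists_isCoordinates (hR : IsRangeSet R)
    (hX : IsUrysohnUniversalUltrametric R X) : ∃ L : X → ℝ → ℕ, IsCoordinates R L := by
  by_cases hc : R.Countable
  · exact (hX.1 hc).exists_isCoordinates hR.2
  · obtain ⟨hv, P, hP⟩ := hX.2 hc
    exact hP.exists_isCoordinates hv hR hc

theorem IsUrysohnUniversalUltrametric.boundedHyperspace (hR : IsRangeSet R) {m : ℕ∞}
    (hm : 1 ≤ m) (l : ℝ≥0∞) (hX : IsUrysohnUniversalUltrametric R X) :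
    IsUrysohnUniversalUltrametric R (BoundedHyperspace X m l) := by
  refine ⟨fun hc => (hX.1 hc).boundedHyperspace hR.2 hm, fun hc => ?_⟩
  obtain ⟨hv, P, hP⟩ := hX.2 hc
  have := hv.ultra
  exact ⟨hv.boundedHyperspace, _, hP.boundedHyperspace hR hc hm⟩

end Coordinates

theorem mainTheorem4 {X : Type*} [MetricSpace X] (R : Set ℝ) (hR : IsRangeSet R)
    (m : ℕ∞) (hm : 2 ≤ m) (l : ℝ≥0∞) (hl : 0 < l)
    (hX : IsUrysohnUniversalUltrametric R X) :
    IsUrysohnUniversalUltrametric R (BoundedHyperspace X m l) ∧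
      Nonempty (BoundedHyperspace X m l ≃ᵢ X) := by
  have hK := hX.boundedHyperspace hR (one_le_two.trans hm) l
  obtain ⟨L, hL⟩ := hK.exists_isCoordinates hR
  obtain ⟨M, hM⟩ := hX.exists_isCoordinates hR
  exact ⟨hK, hL.nonempty_isometryEquiv hM⟩
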